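/- Let $p$ be a prime, $K\ge 1$ and $d, m_1,\dots,m_K,m'_1,\dots,m'_K\ge 0$ integers. An LCBC instance over a finite field $\mathbb F_q$ consists of matrices $\mathbf v_k\in\mathbb F_q^{d\times m_k}$ (demand of user $k$) and $\mathbf v'_k\in\mathbb F_q^{d\times m'_k}$ (side-information of user $k$), $k\in[K]=\{1,\dots,K\}$. A coding scheme consists of a batch size $L\ge 1$, a finite alphabet $\mathcal S$, an encoder $\Phi:\mathbb F_q^{d\times L}\to\mathcal S$ and decoders $\Psi_k:\mathcal S\times\mathbb F_q^{L\times m'_k}\to\mathbb F_q^{L\times m_k}$, $k\in[K]$, none of them necessarily linear. It is achievable for the instance if $\Psi_k(\Phi(\mathbf x),\mathbf x^T\mathbf v'_k)=\mathbf x^T\mathbf v_k$ for all $\mathbf x\in\mathbb F_q^{d\times L}$ and all $k\in[K]$. Its broadcast cost is $\log_q|\mathcal S|/L$, and the optimal broadcast cost $\Delta^*(\Lambda)$ of an instance $\Lambda$ is the infimum of the costs of all schemes that are achievable for it. With $(p,K,d,m_{[K]},m'_{[K]})$ fixed, let $\Lambda_n$ be uniformly distributed on the finite set of all LCBC instances over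 $\mathbb F_{p^n}$ with these dimensions, and put $$\Delta_u^*=\inf\Big\{\Delta\in\mathbb R:\lim_{n\to\infty}\Pr\big(\Delta^*(\Lambda_n)\le\Delta\big)=1\Big\},\qquad \Delta_l^*=\sup\Big\{\Delta\in\mathbb R:\lim_{n\to\infty}\Pr\big(\Delta^*(\Lambda_n)>\Delta\big)=1\Big\}.$$ Then $$\Delta_l^*\ \ge\ \max_{\mathcal K\subseteq[K]}\ \min\Big\{d-\sum_{k\in\mathcal K}m'_k,\ \sum_{k\in\mathcal K}m_k\Big\},$$ $$\Delta_u^*\ \le\ \min\Big\{\frac{m_{\max}\,d}{m_{\max}+m'_{\min}},\ (d-m'_{\min})^+,\ \sum_{k\in[K]}m_k\Big\},$$ where $m_{\max}=\max_{k\in[K]}m_k$, $m'_{\min}=\min_{k\in[K]}m'_k$, $(x)^+=\max\{0,x\}$, and the quotient is read as $0$ if $m_{\max}=m'_{\min}=0$. -/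

import Mathlib

open Filter Topology

/-! # The linear computation broadcast (LCBC) problem and its generic broadcast cost -/

namespace LCBC

/-- An LCBC instance with `K` users over a field `F`: the coefficient matrices of the desired
computations `v k ∈ F^{d × m_k}` and of the side-informations `v' k ∈ F^{d × m'_k}`. -/
@[ext]
structure Instance (F : Type) (K d : ℕ) (m m' : Fin K → ℕ) where
  v : (k : Fin K) → Matrix (Fin d) (Fin (m k)) F
  v' : (k : Fin K) → Matrix (Fin d) (Fin (m' k)) F

/-- A (not necessarily linear) coding scheme: a batch size `L ≥ 1`, a finite broadcast alphabet,
an encoder acting on the data `x ∈ F^{d × L}`, and one decoder for each user, acting on the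
broadcast symbol and that user's side-information. -/
structure Scheme (F : Type) (K d : ℕ) (m m' : Fin K → ℕ) where
  L : ℕ
  L_pos : 0 < L
  alphabet : Type
  finite_alphabet : Finite alphabet
  encode : Matrix (Fin d) (Fin L) F → alphabet
  decode : (k : Fin K) → alphabet → Matrix (Fin L) (Fin (m' k)) F → Matrix (Fin L) (Fin (m k)) F

/-- The broadcast cost `log_q |S| / L`, where `q = |F|`. -/
noncomputable def Scheme.cost {F : Type} {K d : ℕ} {m m' : Fin K → ℕ}
    (s : Scheme F K d m m') : ℝ :=
  Real.logb (Nat.card F) (Nat.card s.alphabet) / s.L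

/-- For every data realization `x`, every user `k` recovers `xᵀ v_k` from the broadcast symbol and
its side-information `xᵀ v'_k`. -/
def Scheme.IsAchievable {F : Type} [Field F] {K d : ℕ} {m m' : Fin K → ℕ}
    (s : Scheme F K d m m') (Λ : Instance F K d m m') : Prop :=
  ∀ (x : Matrix (Fin d) (Fin s.L) F) (k : Fin K),
    s.decode k (s.encode x) (x.transpose * Λ.v' k) = x.transpose * Λ.v k

/-- The costs of all achievable schemes of an instance. -/
def costs {F : Type} [Field F] {K d : ℕ} {m m' : Fin K → ℕ} (Λ : Instance F K d m m') : Set ℝ :=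
  {Δ | ∃ s : Scheme F K d m m', s.IsAchievable Λ ∧ s.cost = Δ}

/-- The optimal broadcast cost `Δ*(Λ)`. -/
noncomputable def optimalCost {F : Type} [Field F] {K d : ℕ} {m m' : Fin K → ℕ}
    (Λ : Instance F K d m m') : ℝ :=
  sInf (costs Λ)

/-- The probability that an instance, uniformly chosen among the finitely many instances over
`𝔽_{p^n}` with the given dimensions, has the property `E`. -/
noncomputable def prob (p : ℕ) [Fact p.Prime] (n K d : ℕ) (m m' : Fin K → ℕ)
    (E : Instance (GaloisField p n) K d m m' → Prop) : ℝ :=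
  (Nat.card {Λ : Instance (GaloisField p n) K d m m' // E Λ} : ℝ) /
    Nat.card (Instance (GaloisField p n) K d m m')

/-- `Δ*(Λ_n) ≤ Δ` asymptotically almost surely as `n → ∞`. -/
def AasLe (p : ℕ) [Fact p.Prime] (K d : ℕ) (m m' : Fin K → ℕ) (Δ : ℝ) : Prop :=
  Tendsto (fun n : ℕ => prob p n K d m m' (fun Λ => optimalCost Λ ≤ Δ)) atTop (𝓝 1)

/-- `Δ*(Λ_n) > Δ` asymptotically almost surely as `n → ∞`. -/
def AasGt (p : ℕ) [Fact p.Prime] (K d : ℕ) (m m' : Fin K → ℕ) (Δ : ℝ) : Prop :=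
  Tendsto (fun n : ℕ => prob p n K d m m' (fun Λ => Δ < optimalCost Λ)) atTop (𝓝 1)

/-- `Δ_u*`: the infimum of the costs that are achievable asymptotically almost surely. -/
noncomputable def upperCost (p : ℕ) [Fact p.Prime] (K d : ℕ) (m m' : Fin K → ℕ) : ℝ :=
  sInf {Δ : ℝ | AasLe p K d m m' Δ}

/-- `Δ_l*`: the supremum of the costs that are not achievable asymptotically almost surely. -/
noncomputable def lowerCost (p : ℕ) [Fact p.Prime] (K d : ℕ) (m m' : Fin K → ℕ) : ℝ :=
  sSup {Δ : ℝ | AasGt p K d m m' Δ}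

/-! The infima and suprema above are taken over non-empty sets that are bounded on the relevant
side, so that they are genuine infima and suprema. -/

section WellDefined

variable {F : Type} [Field F] [Finite F] {K d : ℕ} {m m' : Fin K → ℕ}

theorem Scheme.cost_nonneg (s : Scheme F K d m m') : 0 ≤ s.cost := by
  have := s.finite_alphabet
  have : Nonempty s.alphabet := ⟨s.encode 0⟩
  have hF : (1 : ℝ) < Nat.card F := by exact_mod_cast Finite.one_lt_card
  have hS : (1 : ℝ) ≤ Nat.card s.alphabet := by exact_mod_cast Nat.card_pos
  exact div_nonneg (Real.logb_nonneg hF hS) (Nat.cast_nonneg _)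

theorem costs_bddBelow (Λ : Instance F K d m m') : BddBelow (costs Λ) :=
  ⟨0, by rintro _ ⟨s, _, rfl⟩; exact s.cost_nonneg⟩

/-- Broadcasting the whole data has cost `d`. -/
theorem dim_mem_costs (Λ : Instance F K d m m') : (d : ℝ) ∈ costs Λ := by
  have hF : (1 : ℝ) < Nat.card F := by exact_mod_cast Finite.one_lt_card
  refine ⟨⟨1, one_pos, Matrix (Fin d) (Fin 1) F, inferInstance, id,
    fun k x _ => x.transpose * Λ.v k⟩, fun x k => rfl, ?_⟩
  have : Nat.card (Matrix (Fin d) (Fin 1) F) = Nat.card F ^ d := by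
    simp [Matrix, Nat.card_fun]
  simp only [Scheme.cost, this, Nat.cast_pow, Nat.cast_one, div_one]
  rw [Real.logb_pow, Real.logb_self_eq_one hF, mul_one]

theorem optimalCost_nonneg (Λ : Instance F K d m m') : 0 ≤ optimalCost Λ :=
  le_csInf ⟨_, dim_mem_costs Λ⟩ (by rintro _ ⟨s, _, rfl⟩; exact s.cost_nonneg)

theorem optimalCost_le_dim (Λ : Instance F K d m m') : optimalCost Λ ≤ d :=
  csInf_le (costs_bddBelow Λ) (dim_mem_costs Λ)

instance : Finite (Instance F K d m m') :=
  Finite.of_injective (fun Λ => (Λ.v, Λ.v')) fun Λ Λ' h => by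
    cases Λ; cases Λ'; simpa using h

instance : Nonempty (Instance F K d m m') := ⟨⟨fun _ => 0, fun _ => 0⟩⟩

end WellDefined

section WellDefined

variable (p : ℕ) [Fact p.Prime] (K d : ℕ) (m m' : Fin K → ℕ)

theorem prob_of_forall (n : ℕ) {E : Instance (GaloisField p n) K d m m' → Prop} (h : ∀ Λ, E Λ) :
    prob p n K d m m' E = 1 := by
  have : Nat.card {Λ : Instance (GaloisField p n) K d m m' // E Λ} =
      Nat.card (Instance (GaloisField p n) K d m m') :=
    Nat.card_congr (Equiv.subtypeUnivEquiv h)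
  rw [prob, this, div_self]
  exact_mod_cast Nat.card_pos.ne'

theorem prob_of_forall_not (n : ℕ) {E : Instance (GaloisField p n) K d m m' → Prop}
    (h : ∀ Λ, ¬ E Λ) : prob p n K d m m' E = 0 := by
  have : IsEmpty {Λ : Instance (GaloisField p n) K d m m' // E Λ} := ⟨fun Λ => h _ Λ.2⟩
  simp [prob]

theorem aasLe_nonempty : {Δ : ℝ | AasLe p K d m m' Δ}.Nonempty :=
  ⟨d, by simp [AasLe, prob_of_forall, optimalCost_le_dim]⟩

theorem aasLe_bddBelow : BddBelow {Δ : ℝ | AasLe p K d m m' Δ} := by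
  refine ⟨0, fun Δ hΔ => ?_⟩
  by_contra! h
  have : ∀ n, prob p n K d m m' (fun Λ => optimalCost Λ ≤ Δ) = 0 := fun n =>
    prob_of_forall_not p K d m m' n fun Λ => not_le.2 (h.trans_le (optimalCost_nonneg Λ))
  simp [AasLe, this] at hΔ

theorem aasGt_nonempty : {Δ : ℝ | AasGt p K d m m' Δ}.Nonempty := by
  refine ⟨-1, ?_⟩
  have : ∀ n, prob p n K d m m' (fun Λ => -1 < optimalCost Λ) = 1 := fun n =>
    prob_of_forall p K d m m' n fun Λ => neg_one_lt_zero.trans_le (optimalCost_nonneg Λ)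
  simp [AasGt, this]

theorem aasGt_bddAbove : BddAbove {Δ : ℝ | AasGt p K d m m' Δ} := by
  refine ⟨d, fun Δ hΔ => ?_⟩
  by_contra! h
  have : ∀ n, prob p n K d m m' (fun Λ => Δ < optimalCost Λ) = 0 := fun n =>
    prob_of_forall_not p K d m m' n fun Λ => not_lt.2 ((optimalCost_le_dim Λ).trans h.le)
  simp [AasGt, this] at hΔ

end WellDefined

/-- `m_max`, the largest of finitely many (at least one) numbers. -/
def maxOf {K : ℕ} [NeZero K] (m : Fin K → ℕ) : ℕ :=
  Finset.univ.sup' Finset.univ_nonempty m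

/-- `m'_min`, the smallest of finitely many (at least one) numbers. -/
def minOf {K : ℕ} [NeZero K] (m' : Fin K → ℕ) : ℕ :=
  Finset.univ.inf' Finset.univ_nonempty m'

end LCBC

/-!
For the lower bound, choose `t = min d (∑ k ∈ 𝒦, (m k + m' k))` columns of the users in `𝒦`. Almost
surely their first `t` rows form an invertible matrix, so all of `F ^ t` can be recovered from the
broadcast and the side-informations of `𝒦`, which forces the cost to be at least
`t - ∑ k ∈ 𝒦, m' k`.

For the alignment bound let `κ` be the prime field. Broadcasting the traces of `x ⬝ᵥ u` for `u` in a
`κ`-subspace of `F ^ d` serves user `k` as soon as the subspace meets every coset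
`V_k z + range V'_k`. If `W` and `U` are `κ`-subspaces of `F` of almost equal dimension and the
entries of a tall matrix `A` multiply `W` into `U`, then `A W ^ r ⊆ U ^ d`: after the change of
coordinates that turns the top square block `T_k` of `[V_k, V'_k]` into the identity, the demands of
all users are aligned in `U ^ d`. Such `W` and `U` are built from the monomials of bounded degree in
the entries of `A`. Their span has polynomially bounded dimension, so it grows by a factor less than
`1 + ε` at some degree, and direct sums of its multiples attain every proportion `ρ < 1` of the
dimension of `F` up to `ε`. As `W` does not depend on the `T_k`, a union bound shows that almost
surely no side-information alone falls into `W` as long as `(m + m') ρ < m`. At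
`ρ = m / (m + m') - ε` the cost tends to `m d / (m + m')` as `ε → 0`.
-/

namespace LCBC

open scoped Matrix

section Density

/-- The proportion of the elements of a finite type that have the property `P`, that is, the
probability of `P` under the uniform distribution. -/
noncomputable def density {X : Type*} (P : X → Prop) : ℝ :=
  (Nat.card {x // P x} : ℝ) / Nat.card X

variable {X Y ι : Type*} [Finite X]

theorem density_nonneg {X : Type*} (P : X → Prop) : 0 ≤ density P :=
  div_nonneg (Nat.cast_nonneg _) (Nat.cast_nonneg _)

theorem density_le_one (P : X → Prop) : density P ≤ 1 :=
  div_le_one_of_le₀ (mod_cast Finite.card_subtype_le P) (Nat.cast_nonneg _)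

theorem density_mono {P Q : X → Prop} (h : ∀ x, P x → Q x) : density P ≤ density Q := by
  unfold density
  gcongr
  exact Nat.card_le_card_of_injective (Subtype.map id h)
    (Subtype.map_injective h Function.injective_id)

theorem density_not [Nonempty X] (P : X → Prop) :
    density (fun x => ¬ P x) = 1 - density P := by
  classical
  have hcard : Nat.card {x // P x} + Nat.card {x // ¬ P x} = Nat.card X := by
    rw [← Nat.card_sum, Nat.card_congr (Equiv.sumCompl P)]
  have hX : (Nat.card X : ℝ) ≠ 0 := mod_cast Nat.card_pos.ne'
  rw [eq_sub_iff_add_eq', density, density, ← add_div, div_eq_one_iff_eq hX]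
  exact_mod_cast hcard

theorem density_exists_le [Fintype ι] (P : ι → X → Prop) :
    density (fun x => ∃ i, P i x) ≤ ∑ i, density (P i) := by
  have hcard : Nat.card {x // ∃ i, P i x} ≤ ∑ i, Nat.card {x // P i x} := by
    rw [← Nat.card_sigma]
    refine Nat.card_le_card_of_surjective (fun y => ⟨y.2, y.1, y.2.2⟩) ?_
    rintro ⟨x, i, hx⟩
    exact ⟨⟨i, x, hx⟩, rfl⟩
  simp only [density, ← Finset.sum_div]
  gcongr
  exact_mod_cast hcard

theorem density_or_le (P Q : X → Prop) :
    density (fun x => P x ∨ Q x) ≤ density P + density Q := by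
  refine (density_mono fun x hx => ?_).trans
    ((density_exists_le fun i : Bool => cond i P Q).trans_eq (by simp))
  exact hx.elim (fun h => ⟨true, h⟩) fun h => ⟨false, h⟩

theorem density_forall_mem {F : Type*} (D : Type*) [Fintype D] (W : Set F) :
    density (fun y : D → F => ∀ j, y j ∈ W) =
      ((Nat.card W : ℝ) / Nat.card F) ^ Fintype.card D := by
  have hcard : Nat.card {y : D → F // ∀ j, y j ∈ W} = Nat.card W ^ Fintype.card D := by
    rw [Nat.card_congr (Equiv.subtypePiEquivPi (p := fun _ => (· ∈ W))), Nat.card_fun,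
      Nat.card_eq_fintype_card (α := D)]
  rw [density, hcard, Nat.card_fun, Nat.card_eq_fintype_card (α := D), Nat.cast_pow, Nat.cast_pow,
    div_pow]

theorem density_comp_equiv {X : Type*} (e : X ≃ Y) (P : Y → Prop) :
    density (fun x => P (e x)) = density P := by
  rw [density, density, Nat.card_congr e,
    Nat.card_congr (e.subtypeEquiv (q := P) fun _ => Iff.rfl)]

theorem density_and_comp_le {f : X → X} {P Q : X → Prop} (hf : Set.InjOn f {x | P x}) :
    density (fun x => P x ∧ Q (f x)) ≤ density Q := by
  unfold density
  gcongr
  refine Nat.card_le_card_of_injective (fun x => ⟨f x, x.2.2⟩) fun x y hxy => ?_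
  exact Subtype.ext (hf x.2.1 y.2.1 (congrArg Subtype.val hxy))

theorem density_comp_fst [Nonempty X] (P : Y → Prop) :
    density (fun z : Y × X => P z.1) = density P := by
  have hX : (Nat.card X : ℝ) ≠ 0 := mod_cast Nat.card_pos.ne'
  rw [density, density, Nat.card_congr Equiv.prodSubtypeFstEquivSubtypeProd, Nat.card_prod,
    Nat.card_prod, Nat.cast_mul, Nat.cast_mul, mul_div_mul_right _ _ hX]

theorem density_comp_of_surjective [AddCommGroup X] [AddCommGroup Y] (f : X →+ Y)
    (hf : Function.Surjective f) (P : Y → Prop) : density (fun x => P (f x)) = density P := by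
  obtain ⟨g, hg⟩ := hf.hasRightInverse
  let e : X ≃ Y × f.ker :=
    { toFun := fun x => (f x, ⟨x - g (f x), by simp [AddMonoidHom.mem_ker, hg (f x)]⟩)
      invFun := fun y => g y.1 + y.2
      left_inv := fun x => by simp
      right_inv := fun y => by
        have hy : f (y.2 : X) = 0 := y.2.2
        ext <;> simp [hy, hg y.1] }
  exact (density_comp_equiv e fun y => P y.1).trans (density_comp_fst P)

theorem density_prod_le [Finite Y] [Nonempty Y] {δ : ℝ} (P : X × Y → Prop)
    (h : ∀ y, density (fun x => P (x, y)) ≤ δ) : density P ≤ δ := by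
  have := Fintype.ofFinite Y
  have hY : (0 : ℝ) < Nat.card Y := mod_cast Nat.card_pos
  have hcard : Nat.card {z // P z} = ∑ y, Nat.card {x // P (x, y)} := by
    rw [← Nat.card_sigma]
    exact Nat.card_congr ⟨fun z => ⟨z.1.2, z.1.1, z.2⟩, fun w => ⟨(w.2.1, w.1), w.2.2⟩,
      fun _ => rfl, fun _ => rfl⟩
  calc density P = (∑ y, density fun x => P (x, y)) / Nat.card Y := by
        simp only [density, hcard, ← Finset.sum_div, Nat.card_prod]
        push_cast
        rw [div_div]
    _ ≤ (∑ _y : Y, δ) / Nat.card Y := by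
        gcongr with y
        exact h y
    _ = δ := by
        rw [Finset.sum_const, Finset.card_univ, ← Nat.card_eq_fintype_card, nsmul_eq_mul,
          mul_div_cancel_left₀ _ hY.ne']

end Density

section AlmostAll

variable {α ι : Type*} {l : Filter α} {X : α → Type*} {P Q : ∀ a, X a → Prop}

/-- In a family of finite types, the property `P` holds asymptotically almost surely along the
filter `l`: its density tends to `1`. Both `AasLe` and `AasGt` unfold to properties of this form. -/
def AlmostAll (l : Filter α) (P : ∀ a, X a → Prop) : Prop :=
  Tendsto (fun a => density (P a)) l (𝓝 1)

variable [∀ a, Finite (X a)]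

theorem AlmostAll.mono (h : AlmostAll l P) (hPQ : ∀ a x, P a x → Q a x) : AlmostAll l Q :=
  tendsto_of_tendsto_of_tendsto_of_le_of_le h tendsto_const_nhds
    (fun a => density_mono (hPQ a)) fun _ => density_le_one _

variable [∀ a, Nonempty (X a)]

theorem almostAll_iff_tendsto_density_not :
    AlmostAll l P ↔ Tendsto (fun a => density (fun x => ¬ P a x)) l (𝓝 0) := by
  simp only [AlmostAll, density_not]
  exact ⟨fun h => by simpa using h.const_sub 1, fun h => by simpa using h.const_sub 1⟩

theorem AlmostAll.of_tendsto_density_and_not (hP : AlmostAll l P)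
    (hPQ : Tendsto (fun a => density (fun x => P a x ∧ ¬ Q a x)) l (𝓝 0)) : AlmostAll l Q := by
  rw [almostAll_iff_tendsto_density_not] at hP ⊢
  refine squeeze_zero (fun _ => density_nonneg _) (fun a => ?_) (by simpa using hP.add hPQ)
  exact (density_mono fun x hx => (em (P a x)).symm.imp_right (⟨·, hx⟩)).trans (density_or_le _ _)

theorem AlmostAll.forall [Finite ι] {P : ι → ∀ a, X a → Prop} (h : ∀ i, AlmostAll l (P i)) :
    AlmostAll l fun a x => ∀ i, P i a x := by
  have := Fintype.ofFinite ι
  simp only [almostAll_iff_tendsto_density_not] at h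
  rw [almostAll_iff_tendsto_density_not]
  refine squeeze_zero (fun _ => density_nonneg _) (fun a => ?_)
    (by simpa using tendsto_finsetSum Finset.univ fun i _ => h i)
  simp only [not_forall]
  exact density_exists_le _

end AlmostAll

section Matrix

theorem density_isUnit_matrix (F : Type*) [Field F] [Finite F] (R : Type*) [Fintype R]
    [DecidableEq R] :
    density (fun T : Matrix R R F => IsUnit T) =
      ∏ i : Fin (Fintype.card R), (1 - ((Nat.card F : ℝ) ^ (Fintype.card R - i : ℕ))⁻¹) := by
  have := Fintype.ofFinite F
  have hF : (Fintype.card F : ℝ) ≠ 0 := mod_cast Fintype.card_ne_zero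
  set t := Fintype.card R
  have hunit : Nat.card {T : Matrix (Fin t) (Fin t) F // IsUnit T} =
      ∏ i : Fin t, (Fintype.card F ^ t - Fintype.card F ^ (i : ℕ)) := by
    rw [← Matrix.card_GL_field]
    exact Nat.card_congr Submonoid.unitsTypeEquivIsUnitSubmonoid.symm.toEquiv
  have hall : Nat.card (Matrix (Fin t) (Fin t) F) = ∏ _i : Fin t, Fintype.card F ^ t := by
    simp [Matrix]
  have hreindex := density_comp_equiv
    (Matrix.reindex (α := F) (Fintype.equivFin R) (Fintype.equivFin R)) IsUnit
  simp only [Matrix.reindex_apply, Matrix.isUnit_submatrix_equiv] at hreindex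
  rw [hreindex, density, hunit, hall, Nat.cast_prod, Nat.cast_prod, ← Finset.prod_div_distrib]
  refine Finset.prod_congr rfl fun i _ => ?_
  rw [Nat.cast_sub (Nat.pow_le_pow_right Fintype.card_pos i.2.le), Nat.card_eq_fintype_card,
    Nat.cast_pow, Nat.cast_pow, sub_div, div_self (pow_ne_zero _ hF), pow_sub₀ _ hF i.2.le,
    mul_inv, inv_inv, div_eq_inv_mul]

theorem almostAll_isUnit_matrix {α : Type*} {l : Filter α} {F : α → Type*} [∀ a, Field (F a)]
    [∀ a, Finite (F a)] (hF : Tendsto (fun a => Nat.card (F a)) l atTop) (R : Type*) [Fintype R]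
    [DecidableEq R] : AlmostAll l fun a (T : Matrix R R (F a)) => IsUnit T := by
  simp only [AlmostAll, density_isUnit_matrix]
  have hfactor (i : Fin (Fintype.card R)) :
      Tendsto (fun a => 1 - ((Nat.card (F a) : ℝ) ^ (Fintype.card R - i : ℕ))⁻¹) l (𝓝 1) := by
    have hpow := (tendsto_pow_atTop (α := ℝ) (Nat.sub_ne_zero_of_lt i.2)).comp
      (tendsto_natCast_atTop_atTop.comp hF)
    simpa using hpow.inv_tendsto_atTop.const_sub 1
  simpa using tendsto_finsetProd Finset.univ fun i _ => hfactor i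

theorem tendsto_card_galoisField (p : ℕ) [hp : Fact p.Prime] :
    Tendsto (fun n => Nat.card (GaloisField p n)) atTop atTop := by
  refine (tendsto_pow_atTop_atTop_of_one_lt hp.out.one_lt).congr' ?_
  filter_upwards [eventually_ne_atTop 0] with n hn
  rw [GaloisField.card p n hn]

variable {F : Type*} [AddCommGroup F] [Finite F]

theorem density_submatrix {α β γ δ : Type*} [Finite α] [Finite β] {f : γ → α} {g : δ → β}
    (hf : Function.Injective f) (hg : Function.Injective g) (P : Matrix γ δ F → Prop) :
    density (fun M : Matrix α β F => P (M.submatrix f g)) = density P := by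
  have : Finite (Matrix α β F) := inferInstanceAs (Finite (α → β → F))
  let φ : Matrix α β F →+ Matrix γ δ F :=
    { toFun := fun M => M.submatrix f g
      map_zero' := rfl
      map_add' := fun _ _ => rfl }
  refine density_comp_of_surjective φ (fun N => ?_) P
  obtain ⟨M, hM⟩ := (hf.prodMap hg).surjective_comp_right (γ := F) (Function.uncurry N)
  exact ⟨Function.curry M, funext₂ fun i j => congrFun hM (i, j)⟩

end Matrix

section Columns

/-- Indices of the columns that user `k` contributes to an instance: those of `v k` on the left and
those of `v' k` on the right of the sum. -/
abbrev UserCol {K : ℕ} (m m' : Fin K → ℕ) (k : Fin K) : Type := Fin (m k) ⊕ Fin (m' k)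

/-- Indices of the columns of all users. -/
abbrev Col {K : ℕ} (m m' : Fin K → ℕ) : Type := Σ k, UserCol m m' k

variable {F : Type} {K d : ℕ} {m m' l l' : Fin K → ℕ}

/-- An instance is the same as one matrix that holds all the columns. -/
def Instance.equivMatrix : Instance F K d m m' ≃ Matrix (Fin d) (Col m m') F where
  toFun Λ := fun i c => Matrix.fromCols (Λ.v c.1) (Λ.v' c.1) i c.2
  invFun M := ⟨fun k i a => M i ⟨k, .inl a⟩, fun k i b => M i ⟨k, .inr b⟩⟩
  left_inv _ := rfl
  right_inv M := by ext i ⟨k, a | b⟩ <;> rfl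

/-- The instance that keeps only the first columns of the coefficient matrices. -/
def Instance.restrict (Λ : Instance F K d m m') (h : ∀ k, l k ≤ m k) (h' : ∀ k, l' k ≤ m' k) :
    Instance F K d l l' :=
  ⟨fun k => (Λ.v k).submatrix id (Fin.castLE (h k)),
    fun k => (Λ.v' k).submatrix id (Fin.castLE (h' k))⟩

theorem density_instance_submatrix [AddCommGroup F] [Finite F] {γ δ : Type*} {f : γ → Fin d}
    {g : δ → Col m m'} (hf : Function.Injective f) (hg : Function.Injective g)
    (P : Matrix γ δ F → Prop) :
    density (fun Λ : Instance F K d m m' => P (Λ.equivMatrix.submatrix f g)) = density P :=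
  (density_comp_equiv Instance.equivMatrix fun M => P (M.submatrix f g)).trans
    (density_submatrix hf hg P)

theorem density_restrict [AddCommGroup F] [Finite F] (h : ∀ k, l k ≤ m k) (h' : ∀ k, l' k ≤ m' k)
    (P : Instance F K d l l' → Prop) :
    density (fun Λ : Instance F K d m m' => P (Λ.restrict h h')) = density P := by
  let g : Col l l' → Col m m' :=
    Sigma.map id fun k => Sum.map (Fin.castLE (h k)) (Fin.castLE (h' k))
  have hg : Function.Injective g := Function.injective_id.sigma_map fun k =>
    (Fin.castLE_injective _).sumMap (Fin.castLE_injective _)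
  rw [← density_comp_equiv Instance.equivMatrix.symm P,
    ← density_instance_submatrix (m := m) (m' := m') Function.injective_id hg]
  rfl

theorem almostAll_isUnit_submatrix (p : ℕ) [Fact p.Prime] {R : Type*} [Fintype R] [DecidableEq R]
    {f : R → Fin d} {g : R → Col m m'} (hf : Function.Injective f) (hg : Function.Injective g) :
    AlmostAll atTop fun n (Λ : Instance (GaloisField p n) K d m m') =>
      IsUnit (Λ.equivMatrix.submatrix f g) :=
  (almostAll_isUnit_matrix (tendsto_card_galoisField p) R).congr fun _ =>
    (density_instance_submatrix hf hg _).symm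

end Columns

section LowerBound

variable {F : Type} [Field F] [Finite F] {K d : ℕ} {m m' : Fin K → ℕ}
  {Λ : Instance F K d m m'} {s : Scheme F K d m m'} {𝒦 : Finset (Fin K)} {R : Type*} [Fintype R]

theorem Scheme.IsAchievable.card_pow_le [DecidableEq R] (hs : s.IsAchievable Λ) {g : R → Col m m'}
    (hg : ∀ j, (g j).1 ∈ 𝒦) {N : Matrix R (Fin d) F}
    (hN : N * Λ.equivMatrix.submatrix id g = 1) :
    Nat.card F ^ (Fintype.card R * s.L) ≤
      Nat.card s.alphabet * Nat.card F ^ ((∑ k ∈ 𝒦, m' k) * s.L) := by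
  have := s.finite_alphabet
  have (k : 𝒦) : Finite (Matrix (Fin s.L) (Fin (m' k)) F) :=
    inferInstanceAs (Finite (Fin s.L → Fin (m' k) → F))
  let decodeCols : s.alphabet × ((k : 𝒦) → Matrix (Fin s.L) (Fin (m' k)) F) →
      Matrix (Fin s.L) R F := fun z l j =>
    Matrix.fromCols (s.decode (g j).1 z.1 (z.2 ⟨_, hg j⟩)) (z.2 ⟨_, hg j⟩) l (g j).2
  have hsurj : Function.Surjective decodeCols := fun y => by
    let x : Matrix (Fin d) (Fin s.L) F := (y * N).transpose
    refine ⟨(s.encode x, fun k => x.transpose * Λ.v' k), ?_⟩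
    calc decodeCols (s.encode x, fun k => x.transpose * Λ.v' k)
        = x.transpose * Λ.equivMatrix.submatrix id g := by
          ext l j
          simp only [decodeCols, hs x, ← Matrix.mul_fromCols]
          rfl
      _ = y := by rw [Matrix.transpose_transpose, Matrix.mul_assoc, hN, Matrix.mul_one]
  have hR : Nat.card (Matrix (Fin s.L) R F) = Nat.card F ^ (Fintype.card R * s.L) := by
    simp [Matrix, Nat.card_fun, pow_mul]
  have h𝒦 : Nat.card ((k : 𝒦) → Matrix (Fin s.L) (Fin (m' k)) F) =
      Nat.card F ^ ((∑ k ∈ 𝒦, m' k) * s.L) := by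
    rw [Nat.card_pi, Finset.sum_mul, ← Finset.prod_pow_eq_pow_sum]
    simp only [Matrix, Nat.card_fun, Nat.card_fin, pow_mul]
    exact Finset.prod_coe_sort 𝒦 fun k => (Nat.card F ^ m' k) ^ s.L
  rw [← hR, ← h𝒦, ← Nat.card_prod]
  exact Nat.card_le_card_of_surjective decodeCols hsurj

theorem Scheme.le_cost_of_card_pow_le (s : Scheme F K d m m') {r t : ℕ}
    (h : Nat.card F ^ (r * s.L) ≤ Nat.card s.alphabet * Nat.card F ^ (t * s.L)) :
    (r : ℝ) - t ≤ s.cost := by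
  have := s.finite_alphabet
  have : Nonempty s.alphabet := ⟨s.encode 0⟩
  have hF : 1 < (Nat.card F : ℝ) := mod_cast Finite.one_lt_card
  have hL : (0 : ℝ) < s.L := mod_cast s.L_pos
  have hS : (Nat.card s.alphabet : ℝ) ≠ 0 := mod_cast Nat.card_pos.ne'
  have hlog : (r * s.L : ℝ) ≤ Real.logb (Nat.card F) (Nat.card s.alphabet) + t * s.L := by
    have hpow (a : ℕ) : 0 < (Nat.card F : ℝ) ^ a := pow_pos (zero_lt_one.trans hF) a
    have := Real.logb_le_logb_of_le hF (mod_cast hpow _) (Nat.cast_le (α := ℝ).2 h)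
    push_cast at this
    rwa [Real.logb_mul hS (hpow _).ne', Real.logb_pow, Real.logb_pow,
      Real.logb_self_eq_one hF, mul_one, mul_one, Nat.cast_mul, Nat.cast_mul] at this
  rw [Scheme.cost, le_div_iff₀ hL]
  linarith

theorem le_optimalCost_of_isUnit [DecidableEq R] {f : R → Fin d} {g : R → Col m m'}
    (hg : ∀ j, (g j).1 ∈ 𝒦) (hu : IsUnit (Λ.equivMatrix.submatrix f g)) :
    (Fintype.card R : ℝ) - ∑ k ∈ 𝒦, (m' k : ℝ) ≤ optimalCost Λ := by
  refine le_csInf ⟨_, dim_mem_costs Λ⟩ ?_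
  rintro _ ⟨s, hs, rfl⟩
  obtain ⟨N, hN⟩ := hu.exists_left_inv
  have hleft : N * (1 : Matrix (Fin d) (Fin d) F).submatrix f (Equiv.refl _) *
      Λ.equivMatrix.submatrix id g = 1 := by
    rw [Matrix.mul_assoc, Matrix.one_submatrix_mul]
    exact hN
  exact_mod_cast s.le_cost_of_card_pow_le (hs.card_pow_le hg hleft)

end LowerBound

theorem exists_injective_col {K : ℕ} (m m' : Fin K → ℕ) (𝒦 : Finset (Fin K)) {t : ℕ}
    (ht : t ≤ ∑ k ∈ 𝒦, (m k + m' k)) :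
    ∃ g : Fin t → Col m m', Function.Injective g ∧ ∀ j, (g j).1 ∈ 𝒦 := by
  have hcard : Fintype.card (Fin t) ≤ Fintype.card (Σ k : 𝒦, UserCol m m' k) := by
    simp only [Fintype.card_fin, Fintype.card_sigma, Fintype.card_sum]
    rwa [Finset.sum_coe_sort 𝒦 fun k => m k + m' k]
  obtain ⟨e⟩ := Function.Embedding.nonempty_of_card_le hcard
  exact ⟨fun j => Sigma.map Subtype.val (fun _ => id) (e j),
    (Subtype.val_injective.sigma_map fun _ => Function.injective_id).comp e.injective,
    fun j => (e j).1.2⟩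

theorem le_lowerCost (p : ℕ) [Fact p.Prime] (K d : ℕ) (m m' : Fin K → ℕ)
    (𝒦 : Finset (Fin K)) :
    min ((d : ℝ) - ∑ k ∈ 𝒦, (m' k : ℝ)) (∑ k ∈ 𝒦, (m k : ℝ)) ≤ lowerCost p K d m m' := by
  let t : ℕ := min d (∑ k ∈ 𝒦, (m k + m' k))
  obtain ⟨g, hg, hg𝒦⟩ := exists_injective_col m m' 𝒦 (min_le_right d _ : t ≤ _)
  have hunit := almostAll_isUnit_submatrix p (Fin.castLE_injective (min_le_left d _ : t ≤ d)) hg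
  have ht : min ((d : ℝ) - ∑ k ∈ 𝒦, (m' k : ℝ)) (∑ k ∈ 𝒦, (m k : ℝ)) =
      (t : ℝ) - ∑ k ∈ 𝒦, (m' k : ℝ) := by
    simp only [t, Nat.cast_min, Nat.cast_sum, Nat.cast_add, Finset.sum_add_distrib]
    rw [← min_sub_sub_right, add_sub_cancel_right]
  rw [ht]
  refine le_of_forall_lt fun Δ hΔ => ?_
  obtain ⟨Δ', hΔΔ', hΔ'⟩ := exists_between hΔ
  refine hΔΔ'.trans_le (le_csSup (aasGt_bddAbove p K d m m') ?_)
  exact AlmostAll.mono hunit fun n Λ hΛ =>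
    hΔ'.trans_le (by simpa only [Fintype.card_fin] using le_optimalCost_of_isUnit hg𝒦 hΛ)

section Monotonicity

variable {F : Type} [Field F] [Finite F] {K d : ℕ} {m m' l l' : Fin K → ℕ}

theorem Scheme.IsAchievable.optimalCost_le {s : Scheme F K d m m'} {Λ : Instance F K d m m'}
    (hs : s.IsAchievable Λ) : optimalCost Λ ≤ s.cost :=
  csInf_le (costs_bddBelow Λ) ⟨s, hs, rfl⟩

theorem optimalCost_le_optimalCost_of_eq_mul (Λ : Instance F K d m m') (Γ : Instance F K d l l')
    (A : ∀ k, Matrix (Fin (l k)) (Fin (m k)) F) (A' : ∀ k, Matrix (Fin (m' k)) (Fin (l' k)) F)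
    (hA : ∀ k, Λ.v k = Γ.v k * A k) (hA' : ∀ k, Γ.v' k = Λ.v' k * A' k) :
    optimalCost Λ ≤ optimalCost Γ := by
  refine le_csInf ⟨_, dim_mem_costs Γ⟩ ?_
  rintro _ ⟨s, hs, rfl⟩
  let s' : Scheme F K d m m' := ⟨s.L, s.L_pos, s.alphabet, s.finite_alphabet, s.encode,
    fun k a y => s.decode k a (y * A' k) * A k⟩
  have hs' : s'.IsAchievable Λ := fun x k => by
    calc s.decode k (s.encode x) (xᵀ * Λ.v' k * A' k) * A k = xᵀ * Γ.v k * A k := by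
          rw [Matrix.mul_assoc, ← hA', hs]
      _ = xᵀ * Λ.v k := by rw [Matrix.mul_assoc, ← hA]
  exact hs'.optimalCost_le

theorem optimalCost_restrict_le_optimalCost_restrict (Λ : Instance F K d l m')
    (hl : ∀ k, m k ≤ l k) (hl' : ∀ k, l' k ≤ m' k) :
    optimalCost (Λ.restrict hl fun k => le_refl (m' k)) ≤
      optimalCost (Λ.restrict (fun k => le_refl (l k)) hl') := by
  refine optimalCost_le_optimalCost_of_eq_mul _ _
    (fun k => (1 : Matrix (Fin (l k)) (Fin (l k)) F).submatrix (Equiv.refl _) (Fin.castLE (hl k)))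
    (fun k => (1 : Matrix (Fin (m' k)) (Fin (m' k)) F).submatrix (Equiv.refl _)
      (Fin.castLE (hl' k))) (fun k => ?_) fun k => ?_
  all_goals rw [Matrix.mul_submatrix_one]; rfl

variable {p : ℕ} [Fact p.Prime] {Δ : ℝ}

-- Both random instances are restrictions of one with `l k` demands and `m' k` side-informations.
theorem AasLe.mono (h : AasLe p K d l l' Δ) (hl : ∀ k, m k ≤ l k) (hl' : ∀ k, l' k ≤ m' k) :
    AasLe p K d m m' Δ := by
  have hfew (n : ℕ) : prob p n K d m m' (fun Λ => optimalCost Λ ≤ Δ) =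
      density (fun Λ : Instance (GaloisField p n) K d l m' =>
        optimalCost (Λ.restrict hl fun k => le_refl (m' k)) ≤ Δ) :=
    (density_restrict hl _ fun Λ => optimalCost Λ ≤ Δ).symm
  have hmany (n : ℕ) : prob p n K d l l' (fun Λ => optimalCost Λ ≤ Δ) =
      density (fun Λ : Instance (GaloisField p n) K d l m' =>
        optimalCost (Λ.restrict (fun k => le_refl (l k)) hl') ≤ Δ) :=
    (density_restrict _ hl' fun Λ => optimalCost Λ ≤ Δ).symm
  simp only [AasLe, hmany] at h
  simp only [AasLe, hfew]
  exact AlmostAll.mono h fun n Λ hΛ =>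
    (optimalCost_restrict_le_optimalCost_restrict Λ hl hl').trans hΛ

theorem AasLe.upperCost_le (h : AasLe p K d m m' Δ) : upperCost p K d m m' ≤ Δ :=
  csInf_le (aasLe_bddBelow p K d m m') h

end Monotonicity

section LinearScheme

variable {F : Type} [Field F] [Finite F] {K d : ℕ} {m m' : Fin K → ℕ} (Λ : Instance F K d m m')

theorem optimalCost_le_logb_card {S : Type} [AddCommGroup S] [Finite S] (Φ : (Fin d → F) →+ S)
    (hΦ : ∀ k x, Φ x = 0 → x ᵥ* Λ.v' k = 0 → x ᵥ* Λ.v k = 0) :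
    optimalCost Λ ≤ Real.logb (Nat.card F) (Nat.card S) := by
  have hdecode (k : Fin K) : Function.FactorsThrough
      (fun X : Matrix (Fin d) (Fin 1) F => Xᵀ * Λ.v k) (fun X => (Φ (Xᵀ 0), Xᵀ * Λ.v' k)) := by
    intro X Y hXY
    obtain ⟨hbroadcast, hside⟩ := Prod.mk.inj hXY
    have hdemand := hΦ k (Xᵀ 0 - Yᵀ 0) (by rw [map_sub, hbroadcast, sub_self])
      (by rw [Matrix.sub_vecMul, sub_eq_zero]; exact congrFun hside 0)
    rw [Matrix.sub_vecMul, sub_eq_zero] at hdemand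
    funext i
    rw [Subsingleton.elim i 0]
    exact hdemand
  let s : Scheme F K d m m' := ⟨1, one_pos, S, inferInstance, fun X => Φ (Xᵀ 0), fun k a Y =>
    Function.extend (fun X => (Φ (Xᵀ 0), Xᵀ * Λ.v' k)) (fun X => Xᵀ * Λ.v k) 0 (a, Y)⟩
  have hs : s.IsAchievable Λ := fun X k => (hdecode k).extend_apply 0 X
  simpa [Scheme.cost, s] using hs.optimalCost_le

variable {κ : Type} [Field κ] [Algebra κ F]

theorem logb_card_eq_finrank_div (V : Type*) [AddCommGroup V] [Module κ V] [Module.Finite κ V] :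
    Real.logb (Nat.card F) (Nat.card V) = Module.finrank κ V / Module.finrank κ F := by
  have : Finite κ := Finite.of_injective _ (algebraMap κ F).injective
  have hκ : Real.log (Nat.card κ) ≠ 0 :=
    (Real.log_pos (mod_cast Finite.one_lt_card)).ne'
  rw [Module.natCard_eq_pow_finrank (K := κ) (V := V),
    Module.natCard_eq_pow_finrank (K := κ) (V := F), Real.logb, Nat.cast_pow, Nat.cast_pow,
    Real.log_pow, Real.log_pow, mul_div_mul_right _ _ hκ]

-- The broadcast consists of the traces of all `x ⬝ᵥ u` with `u ∈ U`.
theorem optimalCost_le_finrank_div (U : Submodule κ (Fin d → F))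
    (hU : ∀ k z, ∃ b, Λ.v k *ᵥ z + Λ.v' k *ᵥ b ∈ U) :
    optimalCost Λ ≤ Module.finrank κ U / Module.finrank κ F := by
  have : Finite κ := Finite.of_injective _ (algebraMap κ F).injective
  have : Finite (Module.Dual κ U) := Module.finite_of_finite κ
  let Φ : (Fin d → F) →ₗ[κ] Module.Dual κ U :=
    ((dotProductBilin κ κ).compr₂ (Algebra.trace κ F)).domRestrict₂ U
  have hΦ : ∀ k x, Φ x = 0 → x ᵥ* Λ.v' k = 0 → x ᵥ* Λ.v k = 0 := by
    intro k x hx hside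
    have htrace (z : Fin (m k) → F) : Algebra.trace κ F (x ᵥ* Λ.v k ⬝ᵥ z) = 0 := by
      obtain ⟨b, hb⟩ := hU k z
      calc Algebra.trace κ F (x ᵥ* Λ.v k ⬝ᵥ z)
          = Algebra.trace κ F (x ⬝ᵥ (Λ.v k *ᵥ z + Λ.v' k *ᵥ b)) := by
            rw [dotProduct_add, Matrix.dotProduct_mulVec, Matrix.dotProduct_mulVec, hside,
              zero_dotProduct, add_zero]
        _ = 0 := LinearMap.congr_fun hx ⟨_, hb⟩
    classical
    ext a
    refine (traceForm_nondegenerate κ F).1 _ fun c => ?_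
    simpa using htrace (Pi.single a c)
  refine (optimalCost_le_logb_card Λ Φ.toAddMonoidHom hΦ).trans_eq ?_
  rw [logb_card_eq_finrank_div (κ := κ), Subspace.dual_finrank_eq]

theorem optimalCost_le_of_mulVec_add_mulVec_mem (U : Submodule κ (Fin d → F))
    (Z : ∀ k, Submodule κ (Fin (m k) → F))
    (hZ : ∀ k, ∀ z ∈ Z k, ∃ b, Λ.v k *ᵥ z + Λ.v' k *ᵥ b ∈ U) :
    optimalCost Λ ≤ (Module.finrank κ U +
      ∑ k, ((m k : ℝ) * Module.finrank κ F - Module.finrank κ (Z k))) / Module.finrank κ F := by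
  choose C hC using fun k => Submodule.exists_isCompl (Z k)
  have hCrank (k : Fin K) : (Module.finrank κ (C k) : ℝ) =
      m k * Module.finrank κ F - Module.finrank κ (Z k) := by
    have hrank := Submodule.finrank_add_eq_of_isCompl (hC k)
    rw [Module.finrank_pi_fintype, Finset.sum_const, Finset.card_fin, smul_eq_mul] at hrank
    rw [eq_sub_iff_add_eq']
    exact_mod_cast hrank
  let v (k : Fin K) : C k →ₗ[κ] (Fin d → F) :=
    (Λ.v k).mulVecLin.restrictScalars κ ∘ₗ (C k).subtype
  let φ : (∀ k, C k) →ₗ[κ] (Fin d → F) := LinearMap.lsum κ (fun k => C k) κ v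
  have hφ (k : Fin K) (z : C k) : Λ.v k *ᵥ z ∈ LinearMap.range φ :=
    ⟨Pi.single k z, LinearMap.lsum_piSingle κ (fun k => C k) κ v k z⟩
  refine (optimalCost_le_finrank_div Λ (U ⊔ LinearMap.range φ) fun k z => ?_).trans ?_
  · obtain ⟨y, hy, c, hc, rfl⟩ := Submodule.mem_sup.1
      ((hC k).sup_eq_top ▸ Submodule.mem_top : z ∈ Z k ⊔ C k)
    obtain ⟨b, hb⟩ := hZ k y hy
    refine ⟨b, Submodule.mem_sup.2 ⟨_, hb, _, hφ k ⟨c, hc⟩, ?_⟩⟩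
    rw [Matrix.mulVec_add, add_right_comm]
  · have hrank := (Submodule.finrank_add_le_finrank_add_finrank U (LinearMap.range φ)).trans
      (Nat.add_le_add_left (LinearMap.finrank_range_le φ) _)
    rw [Module.finrank_pi_fintype] at hrank
    simp only [← hCrank]
    gcongr
    exact_mod_cast hrank

theorem optimalCost_le_sum : optimalCost Λ ≤ ∑ k, (m k : ℝ) := by
  simpa using optimalCost_le_of_mulVec_add_mulVec_mem (κ := F) Λ ⊥ (fun _ => ⊥)
    fun k z hz => ⟨0, by simp [(Submodule.mem_bot F).1 hz]⟩

theorem optimalCost_le_sub {R : Type*} [Fintype R] [DecidableEq R] {f : R → Fin d}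
    (hf : Function.Injective f) (g : ∀ k, R → Fin (m' k))
    (hu : ∀ k, IsUnit ((Λ.v' k).submatrix f (g k))) : optimalCost Λ ≤ (d : ℝ) - Fintype.card R := by
  let φ : (Fin d → F) →ₗ[F] (R → F) := LinearMap.funLeft F F f
  have hrank : Module.finrank F (LinearMap.ker φ) = (d : ℝ) - Fintype.card R := by
    have h := LinearMap.finrank_range_add_finrank_ker φ
    rw [LinearMap.range_eq_top.2 (LinearMap.funLeft_surjective_of_injective F F f hf), finrank_top,
      Module.finrank_fintype_fun_eq_card, Module.finrank_fin_fun] at h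
    rw [eq_sub_iff_add_eq']
    exact_mod_cast h
  refine (optimalCost_le_finrank_div Λ (LinearMap.ker φ) fun k z => ?_).trans_eq ?_
  · obtain ⟨c, hc⟩ := Matrix.mulVec_surjective_iff_isUnit.2 (hu k) (-((Λ.v k *ᵥ z) ∘ f))
    let E : Matrix (Fin (m' k)) R F := (1 : Matrix _ _ F).submatrix (Equiv.refl _) (g k)
    have hE : (Λ.v' k *ᵥ E *ᵥ c) ∘ f = -((Λ.v k *ᵥ z) ∘ f) := by
      rw [← hc, Matrix.mulVec_mulVec, Matrix.mul_submatrix_one]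
      rfl
    refine ⟨E *ᵥ c, ?_⟩
    change (Λ.v k *ᵥ z) ∘ f + (Λ.v' k *ᵥ E *ᵥ c) ∘ f = 0
    rw [hE, add_neg_cancel]
  · rw [hrank, Module.finrank_self, Nat.cast_one, div_one]

end LinearScheme

theorem aasLe_sum (p : ℕ) [Fact p.Prime] (K d : ℕ) (m m' : Fin K → ℕ) :
    AasLe p K d m m' (∑ k, (m k : ℝ)) := by
  simp [AasLe, prob_of_forall, optimalCost_le_sum]

theorem aasLe_sub (p : ℕ) [Fact p.Prime] (K d : ℕ) (m m' : Fin K → ℕ) {t : ℕ} (ht : t ≤ d)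
    (ht' : ∀ k, t ≤ m' k) : AasLe p K d m m' ((d : ℝ) - t) := by
  let g (k : Fin K) : Fin t → Col m m' := fun j => ⟨k, .inr (Fin.castLE (ht' k) j)⟩
  have hg (k : Fin K) : Function.Injective (g k) := fun i j hij => by simpa [g] using hij
  have hunit := AlmostAll.forall fun k =>
    almostAll_isUnit_submatrix p (Fin.castLE_injective ht) (hg k)
  exact AlmostAll.mono hunit fun n Λ hΛ => by
    simpa using optimalCost_le_sub Λ (Fin.castLE_injective ht) (fun k => Fin.castLE (ht' k)) hΛ

theorem upperCost_le_sub (p : ℕ) [Fact p.Prime] (K : ℕ) [NeZero K] (d : ℕ) (m m' : Fin K → ℕ) :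
    upperCost p K d m m' ≤ max 0 ((d : ℝ) - minOf m') := by
  have hmin (k : Fin K) : minOf m' ≤ m' k := Finset.inf'_le m' (Finset.mem_univ k)
  refine (aasLe_sub p K d m m' (min_le_left d (minOf m'))
    fun k => (min_le_right d _).trans (hmin k)).upperCost_le.trans_eq ?_
  rw [Nat.cast_min, ← max_sub_sub_left, sub_self]

section Alignment

variable {F : Type} [Field F] {κ : Type} [Field κ] [Algebra κ F] [FiniteDimensional κ F]

theorem finrank_pi_univ_const (ι : Type*) [Fintype ι] (U : Submodule κ F) :
    Module.finrank κ (Submodule.pi Set.univ fun _ : ι => U) =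
      Fintype.card ι * Module.finrank κ U := by
  have hinj : Function.Injective (U.subtype.compLeft ι) := U.injective_subtype.comp_left
  have hrange := LinearMap.finrank_range_of_inj hinj
  rw [LinearMap.range_compLeft, Submodule.range_subtype, Module.finrank_pi_fintype,
    Finset.sum_const, Finset.card_univ, smul_eq_mul] at hrange
  exact hrange

-- `Z` consists of the left halves of the `T⁻¹ *ᵥ w` with `w` in `W`: the matrix `A * T` maps
-- `T⁻¹ *ᵥ w` to `A *ᵥ w`.
theorem exists_finrank_eq_of_fromCols_eq_mul {D α β : Type*} [Fintype α] [Fintype β]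
    [DecidableEq α] [DecidableEq β] {v : Matrix D α F} {v' : Matrix D β F}
    {A : Matrix D (α ⊕ β) F} {T : Matrix (α ⊕ β) (α ⊕ β) F} {W U : Submodule κ F}
    (hv : Matrix.fromCols v v' = A * T) (hT : IsUnit T) (hA : ∀ i j, ∀ w ∈ W, A i j * w ∈ U)
    (hW : ∀ b : β → F, (∀ j, (T *ᵥ Sum.elim 0 b) j ∈ W) → b = 0) :
    ∃ Z : Submodule κ (α → F),
      Module.finrank κ Z = Fintype.card (α ⊕ β) * Module.finrank κ W ∧
      ∀ z ∈ Z, ∃ b, ∀ i, (v *ᵥ z + v' *ᵥ b) i ∈ U := by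
  let X : Submodule κ (α ⊕ β → F) := Submodule.pi Set.univ fun _ => W
  have hTinv (w : α ⊕ β → F) : T *ᵥ T⁻¹ *ᵥ w = w := by
    rw [Matrix.mulVec_mulVec, Matrix.mul_nonsing_inv _ ((Matrix.isUnit_iff_isUnit_det _).1 hT),
      Matrix.one_mulVec]
  let θ : X →ₗ[κ] (α → F) :=
    LinearMap.funLeft κ F Sum.inl ∘ₗ T⁻¹.mulVecLin.restrictScalars κ ∘ₗ X.subtype
  have hθ : Function.Injective θ := by
    rw [injective_iff_map_eq_zero]
    intro w hw
    have hsplit : T⁻¹ *ᵥ w = Sum.elim (0 : α → F) ((T⁻¹ *ᵥ w) ∘ Sum.inr) := by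
      funext j
      exact j.casesOn (congrFun hw) fun _ => rfl
    have hright := hW ((T⁻¹ *ᵥ w) ∘ Sum.inr) fun j => by
      rw [← hsplit, hTinv]
      exact w.2 j (Set.mem_univ j)
    rw [hright, Sum.elim_zero_zero] at hsplit
    ext1
    rw [← hTinv w, hsplit, Matrix.mulVec_zero, Submodule.coe_zero]
  refine ⟨LinearMap.range θ, ?_, ?_⟩
  · rw [LinearMap.finrank_range_of_inj hθ, finrank_pi_univ_const]
  · rintro _ ⟨w, rfl⟩
    refine ⟨(T⁻¹ *ᵥ w) ∘ Sum.inr, fun i => ?_⟩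
    have hprod : v *ᵥ θ w + v' *ᵥ ((T⁻¹ *ᵥ w) ∘ Sum.inr) = A *ᵥ w := by
      conv_rhs => rw [← hTinv w, Matrix.mulVec_mulVec, ← hv, Matrix.fromCols_mulVec]
      rfl
    rw [hprod]
    exact sum_mem fun j _ => hA i j _ (w.2 j (Set.mem_univ j))

variable [Finite F] {K d : ℕ} {m m' : Fin K → ℕ}

theorem optimalCost_le_of_fromCols_eq_mul (Λ : Instance F K d m m') {W U : Submodule κ F}
    {A : ∀ k, Matrix (Fin d) (UserCol m m' k) F}
    {T : ∀ k, Matrix (UserCol m m' k) (UserCol m m' k) F}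
    (hΛ : ∀ k, Matrix.fromCols (Λ.v k) (Λ.v' k) = A k * T k) (hT : ∀ k, IsUnit (T k))
    (hA : ∀ k i j, ∀ w ∈ W, A k i j * w ∈ U)
    (hW : ∀ k (b : Fin (m' k) → F), (∀ j, (T k *ᵥ Sum.elim 0 b) j ∈ W) → b = 0) :
    optimalCost Λ ≤ (d * Module.finrank κ U + ∑ k, ((m k : ℝ) * Module.finrank κ F -
      (m k + m' k) * Module.finrank κ W)) / Module.finrank κ F := by
  choose Z hrank hZ using fun k =>
    exists_finrank_eq_of_fromCols_eq_mul (hΛ k) (hT k) (hA k) (hW k)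
  refine (optimalCost_le_of_mulVec_add_mulVec_mem Λ (Submodule.pi Set.univ fun _ => U) Z
    fun k z hz => (hZ k z hz).imp fun b hb i _ => hb i).trans_eq ?_
  simp [finrank_pi_univ_const, hrank]

end Alignment

section AlmostInvariant

variable {k F : Type*} [Field k] [Field F] [Algebra k F]

/-- Multiplication by each `h t` maps `W` into the hardly larger space `U`, and `W` has about `ρ`
times the dimension of `F`; both deviations are measured by `ε`. -/
structure AlmostInvariant {τ : Type*} (h : τ → F) (ε ρ : ℝ) (W U : Submodule k F) : Prop where
  mul_mem : ∀ t, ∀ w ∈ W, h t * w ∈ U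
  finrank_le : (Module.finrank k U : ℝ) ≤ (1 + ε) * Module.finrank k W
  le_finrank : (ρ - ε) * Module.finrank k F ≤ Module.finrank k W
  finrank_le_mul : (Module.finrank k W : ℝ) ≤ ρ * Module.finrank k F

/-- The span of the monomials in `h` with all exponents at most `N`. -/
def monomialSpan (k : Type*) {F τ : Type*} [Field k] [Field F] [Algebra k F] [Fintype τ]
    (h : τ → F) (N : ℕ) : Submodule k F :=
  Submodule.span k (Set.range fun α : τ → Fin (N + 1) => ∏ t, h t ^ (α t : ℕ))

section MonomialSpan

variable {τ : Type*} [Fintype τ] (h : τ → F)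

theorem one_mem_monomialSpan (N : ℕ) : (1 : F) ∈ monomialSpan k h N :=
  Submodule.subset_span ⟨fun _ => 0, by simp⟩

theorem mul_mem_monomialSpan (N : ℕ) (t : τ) {w : F} (hw : w ∈ monomialSpan k h N) :
    h t * w ∈ monomialSpan k h (N + 1) := by
  classical
  have hle : monomialSpan k h N ≤ (monomialSpan k h (N + 1)).comap (LinearMap.mulLeft k (h t)) := by
    rw [monomialSpan, Submodule.span_le]
    rintro _ ⟨α, rfl⟩
    refine Submodule.subset_span
      ⟨fun s => ⟨α s + if s = t then 1 else 0, by have := (α s).2; split_ifs <;> omega⟩, ?_⟩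
    simp only [pow_add, pow_ite, pow_one, pow_zero, Finset.prod_mul_distrib, Finset.prod_ite_eq',
      Finset.mem_univ, if_true]
    exact mul_comm _ _
  exact hle hw

theorem finrank_monomialSpan_le (N : ℕ) :
    Module.finrank k (monomialSpan k h N) ≤ (N + 1) ^ Fintype.card τ := by
  classical
  exact (finrank_range_le_card _).trans_eq (by simp)

theorem finrank_monomialSpan_pos [FiniteDimensional k F] (N : ℕ) :
    0 < Module.finrank k (monomialSpan k h N) :=
  Module.finrank_pos_iff_exists_ne_zero.2
    ⟨⟨1, one_mem_monomialSpan h N⟩, fun h0 => one_ne_zero (congrArg Subtype.val h0)⟩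

theorem exists_finrank_monomialSpan_succ_le [FiniteDimensional k F] {ε : ℝ} {N : ℕ} (hε : 0 < ε)
    (hN : ((N : ℝ) + 1) ^ Fintype.card τ < (1 + ε) ^ N) :
    ∃ M < N, (Module.finrank k (monomialSpan k h (M + 1)) : ℝ) ≤
      (1 + ε) * Module.finrank k (monomialSpan k h M) := by
  by_contra! hgrow
  have hpow : ∀ M ≤ N, (1 + ε) ^ M ≤ (Module.finrank k (monomialSpan k h M) : ℝ) := by
    intro M
    induction M with
    | zero =>
      rw [pow_zero]
      exact fun _ => mod_cast finrank_monomialSpan_pos h 0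
    | succ M ih =>
      intro hM
      calc (1 + ε) ^ (M + 1) = (1 + ε) * (1 + ε) ^ M := pow_succ' _ _
        _ ≤ (1 + ε) * Module.finrank k (monomialSpan k h M) := by
          gcongr
          exact ih (by omega)
        _ ≤ _ := (hgrow M (by omega)).le
  have hle : (Module.finrank k (monomialSpan k h N) : ℝ) ≤ ((N : ℝ) + 1) ^ Fintype.card τ :=
    mod_cast finrank_monomialSpan_le (k := k) h N
  exact ((hpow N le_rfl).trans hle).not_gt hN

end MonomialSpan

theorem exists_add_one_pow_lt_pow {b : ℝ} (hb : 1 < b) (t : ℕ) :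
    ∃ N : ℕ, ((N : ℝ) + 1) ^ t < b ^ N := by
  have hb0 : 0 < b := zero_lt_one.trans hb
  obtain ⟨N, hN⟩ := (((tendsto_pow_const_div_const_pow_of_one_lt t hb).comp
    (tendsto_add_atTop_nat 1)).eventually (gt_mem_nhds (inv_pos.2 hb0))).exists
  refine ⟨N, ?_⟩
  rw [Function.comp_apply, div_lt_iff₀ (pow_pos hb0 _), pow_succ', inv_mul_cancel_left₀ hb0.ne',
    Nat.cast_add_one] at hN
  exact hN

theorem finrank_map_mulLeft {β : F} (hβ : β ≠ 0) (B : Submodule k F) :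
    Module.finrank k (B.map (LinearMap.mulLeft k β)) = Module.finrank k B :=
  (Submodule.equivMapOfInjective _ (mul_right_injective₀ hβ) B).finrank_eq.symm

variable [Finite k] [FiniteDimensional k F]

-- Take for `β` an element that is not a quotient `w / b` with `w ∈ W` and `b ∈ B`.
theorem exists_disjoint_map_mulLeft (W B : Submodule k F)
    (hWB : Module.finrank k W + Module.finrank k B < Module.finrank k F) :
    ∃ β : F, β ≠ 0 ∧ Disjoint W (B.map (LinearMap.mulLeft k β)) := by
  have : Finite F := Module.finite_of_finite k
  have hcard : Nat.card (W × B) < Nat.card F := by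
    rw [Nat.card_prod, Module.natCard_eq_pow_finrank (K := k) (V := W),
      Module.natCard_eq_pow_finrank (K := k) (V := B),
      Module.natCard_eq_pow_finrank (K := k) (V := F), ← pow_add]
    exact Nat.pow_lt_pow_right Finite.one_lt_card hWB
  have hnot : ¬ Function.Surjective (fun x : W × B => (x.1 : F) / x.2) := fun hsurj =>
    (Nat.card_le_card_of_surjective _ hsurj).not_gt hcard
  simp only [Function.Surjective, not_forall, not_exists] at hnot
  obtain ⟨β, hβ⟩ := hnot
  have hβ0 : β ≠ 0 := by
    rintro rfl
    exact hβ (0, 0) (by simp)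
  refine ⟨β, hβ0, Submodule.disjoint_def.2 ?_⟩
  rintro _ hw ⟨b, hb, rfl⟩
  by_contra hne
  have hb0 : b ≠ 0 := by
    rintro rfl
    exact hne (map_zero _)
  exact hβ (⟨_, hw⟩, ⟨b, hb⟩) (by simp [hb0])

theorem exists_submodule_finrank_eq_mul {τ : Type*} (h : τ → F) {B B' : Submodule k F}
    (hB : ∀ t, ∀ w ∈ B, h t * w ∈ B') (s : ℕ)
    (hs : s * Module.finrank k B < Module.finrank k F) :
    ∃ W U : Submodule k F, (∀ t, ∀ w ∈ W, h t * w ∈ U) ∧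
      Module.finrank k W = s * Module.finrank k B ∧
      Module.finrank k U ≤ s * Module.finrank k B' := by
  induction s with
  | zero => exact ⟨⊥, ⊥, by simp, by simp, by simp⟩
  | succ s ih =>
    rw [add_one_mul] at hs
    obtain ⟨W, U, hWU, hW, hU⟩ := ih (by omega)
    obtain ⟨β, hβ, hdisj⟩ := exists_disjoint_map_mulLeft W B (by omega)
    refine ⟨W ⊔ B.map (LinearMap.mulLeft k β), U ⊔ B'.map (LinearMap.mulLeft k β),
      fun t w hw => ?_, ?_, ?_⟩
    · obtain ⟨x, hx, _, ⟨b, hb, rfl⟩, rfl⟩ := Submodule.mem_sup.1 hw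
      refine Submodule.mem_sup.2 ⟨_, hWU t x hx, _, ⟨h t * b, hB t b hb, rfl⟩, ?_⟩
      simp only [LinearMap.mulLeft_apply]
      ring
    · have hrank := Submodule.finrank_sup_add_finrank_inf_eq W (B.map (LinearMap.mulLeft k β))
      rw [hdisj.eq_bot, finrank_bot, add_zero, finrank_map_mulLeft hβ] at hrank
      rw [hrank, hW, add_one_mul]
    · refine (Submodule.finrank_add_le_finrank_add_finrank _ _).trans ?_
      rw [finrank_map_mulLeft hβ, add_one_mul]
      exact Nat.add_le_add_right hU _

theorem exists_almostInvariant {τ : Type*} [Fintype τ] (h : τ → F) {ε ρ : ℝ} {N : ℕ} (hε : 0 < ε)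
    (hρ0 : 0 ≤ ρ) (hρ1 : ρ < 1) (hN : ((N : ℝ) + 1) ^ Fintype.card τ < (1 + ε) ^ N)
    (hF : ((N : ℝ) + 1) ^ Fintype.card τ ≤ ε * Module.finrank k F) :
    ∃ W U : Submodule k F, AlmostInvariant h ε ρ W U := by
  obtain ⟨M, hM, hgrow⟩ := exists_finrank_monomialSpan_succ_le (k := k) h hε hN
  have hn : (0 : ℝ) < Module.finrank k F := mod_cast Module.finrank_pos
  have ha : (0 : ℝ) < Module.finrank k (monomialSpan k h M) :=
    mod_cast finrank_monomialSpan_pos h M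
  have haε : (Module.finrank k (monomialSpan k h M) : ℝ) ≤ ε * Module.finrank k F :=
    calc (Module.finrank k (monomialSpan k h M) : ℝ) ≤ ((M : ℝ) + 1) ^ Fintype.card τ :=
          mod_cast finrank_monomialSpan_le h M
      _ ≤ ((N : ℝ) + 1) ^ Fintype.card τ := by gcongr
      _ ≤ _ := hF
  set n := Module.finrank k F
  set a := Module.finrank k (monomialSpan k h M)
  let s : ℕ := ⌊ρ * n / a⌋₊
  have hs : (s : ℝ) * a ≤ ρ * n := by
    rw [← le_div_iff₀ ha]
    exact Nat.floor_le (by positivity)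
  have hs' : ρ * n < (s + 1 : ℝ) * a := by
    rw [← div_lt_iff₀ ha]
    exact Nat.lt_floor_add_one _
  have hsn : s * a < n := by
    exact_mod_cast hs.trans_lt (mul_lt_of_lt_one_left hn hρ1)
  obtain ⟨W, U, hWU, hW, hU⟩ := exists_submodule_finrank_eq_mul h
    (fun t w hw => mul_mem_monomialSpan h M t hw) s hsn
  have hW' : (Module.finrank k W : ℝ) = s * a := mod_cast hW
  refine ⟨W, U, hWU, ?_, by linarith, hW'.trans_le hs⟩
  calc (Module.finrank k U : ℝ) ≤ s * Module.finrank k (monomialSpan k h (M + 1)) := mod_cast hU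
    _ ≤ s * ((1 + ε) * a) := by gcongr
    _ = (1 + ε) * Module.finrank k W := by rw [hW', mul_left_comm]

end AlmostInvariant

section Counting

variable {F : Type*} [Field F] [Finite F]

theorem density_mulVec {D R : Type*} [Finite D] [Fintype R] {c : R → F} (hc : c ≠ 0)
    (P : (D → F) → Prop) : density (fun T : Matrix D R F => P (T *ᵥ c)) = density P := by
  classical
  have : Finite (Matrix D R F) := inferInstanceAs (Finite (D → R → F))
  obtain ⟨j, hj⟩ := Function.ne_iff.1 hc
  let φ : Matrix D R F →+ (D → F) :=
    { toFun := fun T => T *ᵥ c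
      map_zero' := Matrix.zero_mulVec c
      map_add' := fun T T' => Matrix.add_mulVec T T' c }
  refine density_comp_of_surjective φ (fun y => ⟨Matrix.vecMulVec y (Pi.single j (c j)⁻¹), ?_⟩) P
  change Matrix.vecMulVec y (Pi.single j (c j)⁻¹) *ᵥ c = y
  rw [Matrix.vecMulVec_mulVec, single_dotProduct, inv_mul_cancel₀ hj, MulOpposite.op_one, one_smul]

theorem density_exists_mulVec_mem_le (D α β : Type*) [Fintype D] [Fintype α] [Fintype β]
    (W : Set F) :
    density (fun T : Matrix D (α ⊕ β) F =>
      ∃ b : β → F, b ≠ 0 ∧ ∀ j, (T *ᵥ Sum.elim 0 b) j ∈ W) ≤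
      (Nat.card F : ℝ) ^ Fintype.card β * ((Nat.card W : ℝ) / Nat.card F) ^ Fintype.card D := by
  classical
  have := Fintype.ofFinite F
  have : Finite (Matrix D (α ⊕ β) F) := inferInstanceAs (Finite (D → α ⊕ β → F))
  have hcard : Fintype.card {b : β → F // b ≠ 0} ≤ Nat.card F ^ Fintype.card β :=
    (Fintype.card_subtype_le _).trans_eq (by rw [Fintype.card_fun, Nat.card_eq_fintype_card])
  have hne (b : {b : β → F // b ≠ 0}) : Sum.elim (0 : α → F) b.1 ≠ 0 := fun h =>
    b.2 (funext fun i => congrFun h (.inr i))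
  calc density (fun T : Matrix D (α ⊕ β) F =>
        ∃ b : β → F, b ≠ 0 ∧ ∀ j, (T *ᵥ Sum.elim 0 b) j ∈ W)
      ≤ density (fun T : Matrix D (α ⊕ β) F =>
        ∃ b : {b : β → F // b ≠ 0}, ∀ j, (T *ᵥ Sum.elim 0 b.1) j ∈ W) :=
        density_mono fun T ⟨b, hb, h⟩ => ⟨⟨b, hb⟩, h⟩
    _ ≤ ∑ b : {b : β → F // b ≠ 0},
        density (fun T : Matrix D (α ⊕ β) F => ∀ j, (T *ᵥ Sum.elim 0 b.1) j ∈ W) :=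
        density_exists_le _
    _ = Fintype.card {b : β → F // b ≠ 0} *
        ((Nat.card W : ℝ) / Nat.card F) ^ Fintype.card D := by
        simp only [density_mulVec (hne _) fun y => ∀ j, y j ∈ W, density_forall_mem,
          Finset.sum_const, Finset.card_univ, nsmul_eq_mul]
    _ ≤ _ := by
        gcongr
        exact_mod_cast hcard

theorem density_exists_mulVec_mem_submodule_le {κ : Type*} [Field κ] [Algebra κ F]
    (α β : Type*) [Fintype α] [Fintype β] {W : Submodule κ F} {ρ : ℝ}
    (hW : (Module.finrank κ W : ℝ) ≤ ρ * Module.finrank κ F) :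
    density (fun T : Matrix (α ⊕ β) (α ⊕ β) F =>
      ∃ b : β → F, b ≠ 0 ∧ ∀ j, (T *ᵥ Sum.elim 0 b) j ∈ W) ≤
      ((Nat.card κ : ℝ) ^ ((Fintype.card α + Fintype.card β) * ρ - Fintype.card α)) ^
        Module.finrank κ F := by
  have : Finite κ := Finite.of_injective _ (algebraMap κ F).injective
  have hκ : 1 < (Nat.card κ : ℝ) := mod_cast Finite.one_lt_card
  have hκ0 := zero_lt_one.trans hκ
  have hcardW : Nat.card (W : Set F) = Nat.card κ ^ Module.finrank κ W :=
    Module.natCard_eq_pow_finrank (V := W)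
  refine (density_exists_mulVec_mem_le (α ⊕ β) α β (W : Set F)).trans ?_
  rw [hcardW, Module.natCard_eq_pow_finrank (K := κ) (V := F), Fintype.card_sum]
  simp only [Nat.cast_pow, ← Real.rpow_natCast, ← Real.rpow_mul hκ0.le, ← Real.rpow_sub hκ0,
    ← Real.rpow_add hκ0]
  refine Real.rpow_le_rpow_of_exponent_le hκ.le ?_
  push_cast
  have hr := mul_le_mul_of_nonneg_left hW
    (by positivity : (0 : ℝ) ≤ Fintype.card α + Fintype.card β)
  linarith

end Counting

section Blocks

variable {F : Type} {K d : ℕ} {m m' : Fin K → ℕ} {Q : Fin K → Type}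

/-- An instance whose rows are cut, separately for each user, into a square block and the remaining
rows. -/
def Instance.equivBlocks (e : ∀ k, UserCol m m' k ⊕ Q k ≃ Fin d) :
    Instance F K d m m' ≃ (∀ k, Matrix (UserCol m m' k) (UserCol m m' k) F) ×
      (∀ k, Matrix (Q k) (UserCol m m' k) F) where
  toFun Λ := (fun k => (Matrix.fromCols (Λ.v k) (Λ.v' k)).submatrix (e k ∘ .inl) id,
    fun k => (Matrix.fromCols (Λ.v k) (Λ.v' k)).submatrix (e k ∘ .inr) id)
  invFun B := ⟨fun k => ((Matrix.fromRows (B.1 k) (B.2 k)).submatrix (e k).symm id).toCols₁,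
    fun k => ((Matrix.fromRows (B.1 k) (B.2 k)).submatrix (e k).symm id).toCols₂⟩
  left_inv Λ := by
    ext k i a <;> obtain ⟨j | q, rfl⟩ := (e k).surjective i <;> simp
  right_inv B := by
    ext k i (a | b) <;> simp

variable [Field F] [Finite F] (e : ∀ k, UserCol m m' k ⊕ Q k ≃ Fin d)
  {κ : Type} [Field κ] [Algebra κ F]

theorem optimalCost_le_of_equivBlocks [FiniteDimensional κ F]
    (Λ : Instance F K d m m') {W U : Submodule κ F}
    (hWU : W ≤ U) (hT : ∀ k, IsUnit ((Λ.equivBlocks e).1 k))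
    (hH : ∀ k q j, ∀ w ∈ W, ((Λ.equivBlocks e).2 k * ((Λ.equivBlocks e).1 k)⁻¹) q j * w ∈ U)
    (hW : ∀ k (b : Fin (m' k) → F),
      (∀ j, ((Λ.equivBlocks e).1 k *ᵥ Sum.elim 0 b) j ∈ W) → b = 0) :
    optimalCost Λ ≤ (d * Module.finrank κ U + ∑ k, ((m k : ℝ) * Module.finrank κ F -
      (m k + m' k) * Module.finrank κ W)) / Module.finrank κ F := by
  set T := (Λ.equivBlocks e).1
  set B := (Λ.equivBlocks e).2
  refine optimalCost_le_of_fromCols_eq_mul Λ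
    (A := fun k => (Matrix.fromRows 1 (B k * (T k)⁻¹)).submatrix (e k).symm id)
    (fun k => ?_) hT (fun k i j w hw => ?_) hW
  · have hblocks : Matrix.fromCols (Λ.v k) (Λ.v' k) =
        (Matrix.fromRows (T k) (B k)).submatrix (e k).symm id := by
      ext i j
      obtain ⟨i | q, rfl⟩ := (e k).surjective i <;> simp [T, B, Instance.equivBlocks]
    have hmul : Matrix.fromRows 1 (B k * (T k)⁻¹) * T k = Matrix.fromRows (T k) (B k) := by
      rw [Matrix.fromRows_mul, Matrix.one_mul,
        Matrix.nonsing_inv_mul_cancel_right _ _ ((Matrix.isUnit_iff_isUnit_det _).1 (hT k))]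
    rw [hblocks, ← hmul]
    rfl
  · obtain ⟨i | q, rfl⟩ := (e k).surjective i
    · by_cases hij : i = j
      · simpa [hij] using hWU hw
      · simp [Matrix.one_apply_ne hij]
    · simpa using hH k q j w hw

theorem density_isUnit_and_le {ι : Type*} [Finite ι] {R Q : ι → Type*} [∀ k, Fintype (R k)]
    [∀ k, DecidableEq (R k)] [∀ k, Finite (Q k)]
    (E : (∀ k, Matrix (R k) (R k) F) × (∀ k, Matrix (Q k) (R k) F) → Prop) :
    density (fun B : (∀ k, Matrix (R k) (R k) F) × (∀ k, Matrix (Q k) (R k) F) =>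
      (∀ k, IsUnit (B.1 k)) ∧ E (B.1, fun k => B.2 k * (B.1 k)⁻¹)) ≤ density E := by
  have (k : ι) : Finite (Matrix (R k) (R k) F) := inferInstanceAs (Finite (R k → R k → F))
  have (k : ι) : Finite (Matrix (Q k) (R k) F) := inferInstanceAs (Finite (Q k → R k → F))
  refine density_and_comp_le (Q := E) ?_
  rintro ⟨T, B⟩ hT ⟨T', B'⟩ hT' h
  obtain ⟨rfl, h⟩ := Prod.mk.inj h
  congr 1
  funext k
  have hdet := (Matrix.isUnit_iff_isUnit_det _).1 (hT k)
  rw [← Matrix.nonsing_inv_mul_cancel_right _ (B k) hdet,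
    ← Matrix.nonsing_inv_mul_cancel_right _ (B' k) hdet]
  exact congrArg (· * T k) (congrFun h k)

end Blocks

section AlignedCost

variable {F : Type} {K d : ℕ} {m m' : Fin K → ℕ} {Q : Fin K → Type}

/-- The cost of the alignment scheme that is built on an almost invariant subspace with parameters
`ε` and `ρ`. -/
noncomputable def alignedCost {K : ℕ} (d : ℕ) (m m' : Fin K → ℕ) (ε ρ : ℝ) : ℝ :=
  d * ((1 + ε) * ρ) + ∑ k, (m k - (m k + m' k) * (ρ - ε))

/-- The number `1` and all the entries of the matrices `H k`. -/
def entriesWithOne [One F] (H : ∀ k, Matrix (Q k) (UserCol m m' k) F) :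
    Option (Σ k, Q k × UserCol m m' k) → F
  | none => 1
  | some ⟨k, q, j⟩ => H k q j

variable [Field F] [Finite F] {κ : Type} [Field κ] [Algebra κ F] [FiniteDimensional κ F]
  (e : ∀ k, UserCol m m' k ⊕ Q k ≃ Fin d) {ε ρ : ℝ}

theorem optimalCost_le_alignedCost (hε : 0 ≤ ε) (Λ : Instance F K d m m') {W U : Submodule κ F}
    (hT : ∀ k, IsUnit ((Λ.equivBlocks e).1 k))
    (hWU : AlmostInvariant
      (entriesWithOne fun k => (Λ.equivBlocks e).2 k * ((Λ.equivBlocks e).1 k)⁻¹) ε ρ W U)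
    (hW : ∀ k (b : Fin (m' k) → F),
      (∀ j, ((Λ.equivBlocks e).1 k *ᵥ Sum.elim 0 b) j ∈ W) → b = 0) :
    optimalCost Λ ≤ alignedCost d m m' ε ρ := by
  have hn : (0 : ℝ) < Module.finrank κ F := mod_cast Module.finrank_pos
  have hle : W ≤ U := fun w hw => by simpa [entriesWithOne] using hWU.mul_mem none w hw
  refine (optimalCost_le_of_equivBlocks e Λ hle hT
    (fun k q j => hWU.mul_mem (some ⟨k, q, j⟩)) hW).trans ?_
  rw [div_le_iff₀ hn, alignedCost, add_mul, Finset.sum_mul]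
  refine add_le_add ?_ (Finset.sum_le_sum fun k _ => ?_)
  · calc (d : ℝ) * Module.finrank κ U ≤ d * ((1 + ε) * (ρ * Module.finrank κ F)) := by
          gcongr
          exact hWU.finrank_le.trans
            (mul_le_mul_of_nonneg_left hWU.finrank_le_mul (by linarith))
      _ = d * ((1 + ε) * ρ) * Module.finrank κ F := by ring
  · calc (m k : ℝ) * Module.finrank κ F - (m k + m' k) * Module.finrank κ W
        ≤ m k * Module.finrank κ F - (m k + m' k) * ((ρ - ε) * Module.finrank κ F) := by
          gcongr
          exact hWU.le_finrank
      _ = (m k - (m k + m' k) * (ρ - ε)) * Module.finrank κ F := by ring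

-- The almost invariant subspace depends only on the `B k * (T k)⁻¹`, which remain uniformly
-- distributed when the square blocks `T k` are given.
theorem density_isUnit_and_alignedCost_lt_le [∀ k, Finite (Q k)] (hε : 0 ≤ ε)
    (hH : ∀ H : ∀ k, Matrix (Q k) (UserCol m m' k) F,
      ∃ W U : Submodule κ F, AlmostInvariant (entriesWithOne H) ε ρ W U) :
    density (fun Λ : Instance F K d m m' => (∀ k, IsUnit ((Λ.equivBlocks e).1 k)) ∧
      ¬ optimalCost Λ ≤ alignedCost d m m' ε ρ) ≤
      ∑ k, ((Nat.card κ : ℝ) ^ ((m k + m' k) * ρ - m k : ℝ)) ^ Module.finrank κ F := by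
  have (k : Fin K) : Finite (Matrix (UserCol m m' k) (UserCol m m' k) F) :=
    inferInstanceAs (Finite (UserCol m m' k → UserCol m m' k → F))
  have (k : Fin K) : Finite (Matrix (Q k) (UserCol m m' k) F) :=
    inferInstanceAs (Finite (Q k → UserCol m m' k → F))
  choose W U hWU using hH
  let E : (∀ k, Matrix (UserCol m m' k) (UserCol m m' k) F) ×
      (∀ k, Matrix (Q k) (UserCol m m' k) F) → Prop := fun B =>
    ∃ k, ∃ b : Fin (m' k) → F, b ≠ 0 ∧ ∀ j, (B.1 k *ᵥ Sum.elim 0 b) j ∈ W B.2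
  have hE (H) : density (fun T => E (T, H)) ≤
      ∑ k, ((Nat.card κ : ℝ) ^ ((m k + m' k) * ρ - m k : ℝ)) ^ Module.finrank κ F := by
    refine (density_exists_le _).trans (Finset.sum_le_sum fun k _ => ?_)
    have heval := density_comp_of_surjective (Pi.evalAddMonoidHom
      (fun k => Matrix (UserCol m m' k) (UserCol m m' k) F) k) (Function.surjective_eval k)
      fun T => ∃ b : Fin (m' k) → F, b ≠ 0 ∧ ∀ j, (T *ᵥ Sum.elim 0 b) j ∈ W H
    refine heval.trans_le ?_
    simpa using density_exists_mulVec_mem_submodule_le (Fin (m k)) (Fin (m' k))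
      (hWU H).finrank_le_mul
  refine (density_mono fun Λ hΛ => ?_).trans <|
    (density_comp_equiv (Instance.equivBlocks e) _).trans_le <|
    (density_isUnit_and_le E).trans (density_prod_le E hE)
  refine ⟨hΛ.1, not_not.1 fun hnot => hΛ.2 ?_⟩
  refine optimalCost_le_alignedCost e hε Λ hΛ.1 (hWU _) fun k b hb => ?_
  exact not_not.1 fun hb0 => hnot ⟨k, b, hb0, hb⟩

end AlignedCost

section Asymptotics

variable (p : ℕ) [hp : Fact p.Prime] {K d : ℕ} {m m' : Fin K → ℕ}

theorem aasLe_alignedCost {ε ρ : ℝ} (hε : 0 < ε) (hρ0 : 0 ≤ ρ) (hρ1 : ρ < 1)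
    (hd : ∀ k, m k + m' k ≤ d) (hρ : ∀ k, (m k + m' k) * ρ < m k) :
    AasLe p K d m m' (alignedCost d m m' ε ρ) := by
  let e (k : Fin K) : UserCol m m' k ⊕ Fin (d - (m k + m' k)) ≃ Fin d :=
    ((finSumFinEquiv.sumCongr (Equiv.refl _)).trans finSumFinEquiv).trans
      (finCongr (Nat.add_sub_of_le (hd k)))
  have hunit : AlmostAll atTop fun n (Λ : Instance (GaloisField p n) K d m m') =>
      ∀ k, IsUnit ((Λ.equivBlocks e).1 k) := AlmostAll.forall fun k =>
    almostAll_isUnit_submatrix p (f := e k ∘ .inl) (g := Sigma.mk k)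
      ((e k).injective.comp Sum.inl_injective) sigma_mk_injective
  refine hunit.of_tendsto_density_and_not ?_
  have hp1 : (1 : ℝ) < p := mod_cast hp.out.one_lt
  have hbound : Tendsto (fun n : ℕ => ∑ k, ((p : ℝ) ^ ((m k + m' k) * ρ - m k : ℝ)) ^ n)
      atTop (𝓝 0) := by
    simpa using tendsto_finsetSum Finset.univ fun k _ => tendsto_pow_atTop_nhds_zero_of_lt_one
      (Real.rpow_nonneg (Nat.cast_nonneg p) _)
      (Real.rpow_lt_one_of_one_lt_of_neg hp1 (sub_neg.2 (hρ k)))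
  obtain ⟨N, hN⟩ := exists_add_one_pow_lt_pow (lt_add_of_pos_right 1 hε)
    (Fintype.card (Option (Σ k, Fin (d - (m k + m' k)) × UserCol m m' k)))
  refine squeeze_zero' (Eventually.of_forall fun _ => density_nonneg _) ?_ hbound
  filter_upwards [eventually_ne_atTop 0, (tendsto_natCast_atTop_atTop.const_mul_atTop
    hε).eventually_ge_atTop _] with n hn0 hn
  rw [← GaloisField.finrank p hn0] at hn
  simpa only [GaloisField.finrank p hn0, Nat.card_zmod] using
    density_isUnit_and_alignedCost_lt_le (F := GaloisField p n) (κ := ZMod p) e hε.le fun H =>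
      exists_almostInvariant (entriesWithOne H) hε hρ0 hρ1 hN hn

theorem tendsto_alignedCost_const (K d : ℕ) {M M' : ℕ} (hM : 0 < M) :
    Tendsto (fun ε : ℝ => alignedCost d (fun _ : Fin K => M) (fun _ => M') ε
      ((M : ℝ) / (M + M') - ε)) (𝓝[>] 0) (𝓝 ((M : ℝ) * d / (M + M'))) := by
  have hcont : Continuous fun ε : ℝ => alignedCost d (fun _ : Fin K => M) (fun _ => M') ε
      ((M : ℝ) / (M + M') - ε) := by
    unfold alignedCost
    fun_prop
  have hne : (M + M' : ℝ) ≠ 0 := by positivity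
  convert (hcont.tendsto 0).mono_left nhdsWithin_le_nhds using 2
  simp [alignedCost, mul_div_cancel₀ _ hne]
  ring

theorem upperCost_le_mul_div {M M' : ℕ} (hM : 0 < M) (hd : M + M' ≤ d)
    (hm : ∀ k, m k ≤ M) (hm' : ∀ k, M' ≤ m' k) :
    upperCost p K d m m' ≤ (M : ℝ) * d / (M + M') := by
  have hr : (0 : ℝ) < M + M' := by positivity
  refine ge_of_tendsto (tendsto_alignedCost_const K d hM) ?_
  filter_upwards [self_mem_nhdsWithin, nhdsWithin_le_nhds (Iio_mem_nhds (by positivity :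
    (0 : ℝ) < M / (M + M')))] with ε hε hε'
  have hε0 : 0 < ε := hε
  have hle : (M : ℝ) / (M + M') ≤ 1 := div_le_one_of_le₀ (by simp) hr.le
  refine ((aasLe_alignedCost p hε0 (sub_nonneg.2 (le_of_lt hε')) (by linarith) (fun _ => hd)
    fun _ => ?_).mono hm hm').upperCost_le
  rw [mul_sub, mul_div_cancel₀ _ hr.ne']
  exact sub_lt_self _ (mul_pos hr hε0)

theorem upperCost_le_maxOf_mul_div (K : ℕ) [NeZero K] (d : ℕ) (m m' : Fin K → ℕ) :
    upperCost p K d m m' ≤ (maxOf m : ℝ) * d / ((maxOf m : ℝ) + minOf m') := by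
  have hmax (k : Fin K) : m k ≤ maxOf m := Finset.le_sup' m (Finset.mem_univ k)
  have hmin (k : Fin K) : minOf m' ≤ m' k := Finset.inf'_le m' (Finset.mem_univ k)
  generalize maxOf m = M at hmax ⊢
  generalize minOf m' = M' at hmin ⊢
  rcases Nat.eq_zero_or_pos M with rfl | hM
  · have hm (k : Fin K) : m k = 0 := Nat.le_zero.1 (hmax k)
    simpa [hm] using (aasLe_sum p K d m m').upperCost_le
  rcases le_total (M + M') d with hd | hd
  · exact upperCost_le_mul_div p hM hd hmax hmin
  · have hd' : (d : ℝ) ≤ M + M' := mod_cast hd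
    refine (aasLe_sub p K d m m' (min_le_left d M')
      fun k => (min_le_right d M').trans (hmin k)).upperCost_le.trans ?_
    rw [le_div_iff₀ (by positivity)]
    rcases le_total d M' with h | h
    · rw [min_eq_left h, sub_self, zero_mul]
      positivity
    · rw [min_eq_right h]
      nlinarith

end Asymptotics

end LCBC

theorem corollary1 (p : ℕ) [Fact p.Prime] (K : ℕ) [NeZero K] (d : ℕ) (m m' : Fin K → ℕ) :
    (Finset.univ : Finset (Finset (Fin K))).sup' Finset.univ_nonempty
        (fun 𝒦 => min ((d : ℝ) - ∑ k ∈ 𝒦, (m' k : ℝ)) (∑ k ∈ 𝒦, (m k : ℝ)))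
      ≤ LCBC.lowerCost p K d m m' ∧
    LCBC.upperCost p K d m m' ≤
      min ((LCBC.maxOf m : ℝ) * d / ((LCBC.maxOf m : ℝ) + LCBC.minOf m'))
        (min (max 0 ((d : ℝ) - LCBC.minOf m')) (∑ k, (m k : ℝ))) := by
  exact ⟨Finset.sup'_le _ _ fun 𝒦 _ => LCBC.le_lowerCost p K d m m' 𝒦,
    le_min (LCBC.upperCost_le_maxOf_mul_div p K d m m')
      (le_min (LCBC.upperCost_le_sub p K d m m') (LCBC.aasLe_sum p K d m m').upperCost_le)⟩
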